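/- Let $n,m,d_1,d_2\ge 1$ be integers such that $\frac{n}{d_1}$ is an integer and $\frac{m}{d_2}\ge\frac{n}{d_1}$. Consider the class of all random $n\times m$ matrices $X$ (on arbitrary probability spaces) of the form $X_{ij}=b_{ij}\xi_{ij}$, where $b_{ij}\ge 0$ are scalars with $$\max_{i\le n,\,j\le m} b_{ij}^2=1,\qquad \max_{j\le m}\sum_{i\le n} b_{ij}^2\le d_1,\qquad \max_{i\le n}\sum_{j\le m} b_{ij}^2\le d_2,$$ and $\xi_{ij}$ are independent, symmetrically distributed real random variables with $\mathbf{E}[\xi_{ij}^{2p}]\le\mathbf{E}[g^{2p}]<\infty$ for all $i,j$ and all $p\in\mathbb{N}$, where $g\sim N(0,1)$. Let $Y$ be the random $n\times m$ block-diagonal matrix with $\frac{n}{d_1}$ consecutive diagonal blocks of dimension $d_1\times d_2$, whose entries inside the blocks are i.i.d. $N(0,1)$ and whose other entries are zero; that is, for $1\le k\le \frac{n}{d_1}$ the $k$-th block occupies rows $(k-1)d_1+1,\dots,kd_1$ and columns $(k-1)d_2+1,\dots,kd_2$, and the last $m-\frac{n}{d_1}d_2$ columns vanish. Then such a matrix $Y$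 exists and belongs to the class, and it simultaneously maximizes all unnormalized trace moments over the class: for every $X$ in the class and every integer $p\ge 0$, both $\mathrm{Tr}\,(XX^*)^p$ and $\mathrm{Tr}\,(YY^*)^p$ are integrable and $$\mathbf{E}[\mathrm{Tr}\,(XX^*)^p]\le\mathbf{E}[\mathrm{Tr}\,(YY^*)^p].$$ -/

import Mathlib

open MeasureTheory ProbabilityTheory
open scoped Matrix

namespace RandMat

/-- The largest squared column length `max_j ∑_i b_ij²` of a coefficient matrix
(a genuine maximum as soon as there is a column). -/
noncomputable def sigmaOneSq {n m : ℕ} (b : Matrix (Fin n) (Fin m) ℝ) : ℝ :=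
  ⨆ j : Fin m, ∑ i : Fin n, b i j ^ 2

/-- The largest squared row length `max_i ∑_j b_ij²` of a coefficient matrix. -/
noncomputable def sigmaTwoSq {n m : ℕ} (b : Matrix (Fin n) (Fin m) ℝ) : ℝ :=
  ⨆ i : Fin n, ∑ j : Fin m, b i j ^ 2

/-- The largest squared entry `max_{i,j} b_ij²` of a coefficient matrix. -/
noncomputable def sigmaStarSq {n m : ℕ} (b : Matrix (Fin n) (Fin m) ℝ) : ℝ :=
  ⨆ e : Fin n × Fin m, b e.1 e.2 ^ 2

/-- The independent entry model with coefficients `b`: `X_ij = b_ij ξ_ij` with `b_ij ≥ 0` and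
`ξ_ij` independent, symmetrically distributed real random variables whose even moments are
(finite and) at most those of a standard Gaussian variable. -/
def IsIndepEntryModel {Ω : Type*} [MeasurableSpace Ω] (P : Measure Ω) {n m : ℕ}
    (b : Matrix (Fin n) (Fin m) ℝ) (X : Ω → Matrix (Fin n) (Fin m) ℝ) : Prop :=
  (∀ i j, 0 ≤ b i j) ∧
  ∃ ξ : Fin n × Fin m → Ω → ℝ,
    (∀ e, Measurable (ξ e)) ∧
    iIndepFun ξ P ∧
    (∀ e, P.map (fun ω => -ξ e ω) = P.map (ξ e)) ∧
    (∀ e, ∀ p : ℕ, Integrable (fun ω => ξ e ω ^ (2 * p)) P ∧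
      ∫ ω, ξ e ω ^ (2 * p) ∂P ≤ ∫ x, x ^ (2 * p) ∂(gaussianReal 0 1)) ∧
    ∀ ω i j, X ω i j = b i j * ξ (i, j) ω

/-- The competitors: random matrices of the independent entry model with
`σ_*² = 1`, `σ_1² ≤ d₁` and `σ_2² ≤ d₂`. -/
def IsAdmissible {Ω : Type*} [MeasurableSpace Ω] (P : Measure Ω) {n m : ℕ} (d₁ d₂ : ℕ)
    (X : Ω → Matrix (Fin n) (Fin m) ℝ) : Prop :=
  ∃ b : Matrix (Fin n) (Fin m) ℝ, IsIndepEntryModel P b X ∧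
    sigmaStarSq b = 1 ∧ sigmaOneSq b ≤ d₁ ∧ sigmaTwoSq b ≤ d₂

/-- The position `(i, j)` (counted from zero) lies in one of the consecutive diagonal blocks of
size `d₁ × d₂`. If `d₁` divides `n` and `n / d₁ ≤ m / d₂`, there are exactly `n / d₁` complete
blocks in an `n × m` matrix, and the columns with index at least `(n / d₁) * d₂` meet none. -/
def InBlock {n m : ℕ} (d₁ d₂ : ℕ) (e : Fin n × Fin m) : Prop :=
  (e.1 : ℕ) / d₁ = (e.2 : ℕ) / d₂

/-- `Y` is an `n × m` block-diagonal random matrix with `d₁ × d₂` blocks: the entries in the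
blocks are i.i.d. standard Gaussian variables and all other entries vanish. -/
def IsBlockGaussian {Ω : Type*} [MeasurableSpace Ω] (P : Measure Ω) {n m : ℕ} (d₁ d₂ : ℕ)
    (Y : Ω → Matrix (Fin n) (Fin m) ℝ) : Prop :=
  (∀ i j, Measurable fun ω => Y ω i j) ∧
  iIndepFun (fun (e : {e : Fin n × Fin m // InBlock d₁ d₂ e}) ω => Y ω e.1.1 e.1.2) P ∧
  (∀ i j, InBlock d₁ d₂ (i, j) → P.map (fun ω => Y ω i j) = gaussianReal 0 1) ∧
  ∀ i j, ¬ InBlock d₁ d₂ (i, j) → ∀ ω, Y ω i j = 0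

/-- The random variable `Tr (X X*)^p`, with the unnormalized trace. -/
noncomputable def tracePow {Ω : Type*} {n m : ℕ} (X : Ω → Matrix (Fin n) (Fin m) ℝ) (p : ℕ)
    (ω : Ω) : ℝ :=
  ((X ω * (X ω)ᴴ) ^ p).trace

end RandMat

/-! Expanding the trace turns `E Tr (XX*)^p` into a sum over closed walks of length `2p` from a row
index in the complete bipartite graph of row and column indices, each weighted by the product of the
`b` along its steps and by the expectation of the product of the `ξ`. That expectation factors over
edges. Odd moments vanish and even ones are at most Gaussian, so it is at most the number of
pairings of the steps that match equal edges, with equality for Gaussians (`integral_prod_word_le`,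
`integral_prod_word_eq`). After exchanging sums it suffices to compare, for each pairing `π`, the
total weight `pairedSum` of the walks respecting `π`.

Such a `π` forces identifications among the times `0, …, 2p`, and a walk is determined by its
vertices at the earliest time of each class. A step arriving at such a time is the earlier one of
its pair, so, since `b ≤ 1`, the weight is at most the product of `b²` over these steps. Summing out
vertices from the last one backwards, each new column costs at most `d₂`, each new row at most `d₁`,
and the start costs `n` (`pairedSum_le`). This bound depends only on `π`, `n`, `d₁`, `d₂`. The block
matrix reaches it: its coefficients are 0 or 1, walks of nonzero weight never leave their block, and
the relevant row and column sums are exactly `d₂` and `d₁` (`le_pairedSum_blockCoeff`). -/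

namespace RandMat

/-! ### Gaussian moments as numbers of pairings -/

/-- The moments of the standard Gaussian distribution. -/
noncomputable def gaussMoment (k : ℕ) : ℝ := ∫ x, x ^ k ∂(gaussianReal 0 1)

/-- The pairings (perfect matchings) of a finite type, as fixed-point-free involutions. -/
def pairings (ι : Type*) [Fintype ι] [DecidableEq ι] : Finset (Equiv.Perm ι) :=
  Finset.univ.filter fun π => (∀ t, π (π t) = t) ∧ ∀ t, π t ≠ t

lemma mem_pairings {ι : Type*} [Fintype ι] [DecidableEq ι] {π : Equiv.Perm ι} :
    π ∈ pairings ι ↔ (∀ t, π (π t) = t) ∧ ∀ t, π t ≠ t := by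
  simp [pairings]

lemma gaussMoment_two_mul (k : ℕ) :
    gaussMoment (2 * k) * (2 ^ k * k.factorial) = (2 * k).factorial := by
  have h1 : gaussMoment (2 * k) =
      (√(2 * Real.pi))⁻¹ * ∫ x : ℝ, x ^ (2 * k) * Real.exp (-(1 / 2) * x ^ 2) := by
    rw [gaussMoment, integral_gaussianReal_eq_integral_smul one_ne_zero, ← integral_const_mul]
    congr 1
    ext x
    simp only [gaussianPDFReal, NNReal.coe_one, mul_one, sub_zero, smul_eq_mul]
    ring_nf
  have h2 : ∫ x : ℝ, x ^ (2 * k) * Real.exp (-(1 / 2) * x ^ 2) =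
      2 * ∫ x in Set.Ioi (0 : ℝ), x ^ ((2 * k : ℕ) : ℝ) * Real.exp (-(1 / 2) * x ^ (2 : ℝ)) := by
    have := integral_comp_abs (f := fun x : ℝ => x ^ (2 * k) * Real.exp (-(1 / 2) * x ^ 2))
    simp only [Real.rpow_natCast, Real.rpow_two]
    rw [← this]
    congr 1
    ext x
    rw [pow_mul, pow_mul, sq_abs]
  rw [h1, h2, integral_rpow_mul_exp_neg_mul_rpow (by norm_num)
    (by have : (0 : ℝ) ≤ ((2 * k : ℕ) : ℝ) := by positivity
        linarith) (by norm_num)]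
  have e1 : (((2 * k : ℕ) : ℝ) + 1) / 2 = k + 1 / 2 := by push_cast; ring
  rw [neg_div, e1, Real.Gamma_nat_add_half, Real.rpow_neg (by norm_num),
    Real.rpow_add (by norm_num), Real.rpow_natCast, ← Real.sqrt_eq_rpow]
  have h3 : √(1 / 2 : ℝ) = (√2)⁻¹ := by rw [one_div, Real.sqrt_inv]
  have h4 : √(2 * Real.pi) = √2 * √Real.pi := Real.sqrt_mul (by norm_num) _
  have h5 : (((2 * k).factorial : ℕ) : ℝ)
      = 2 ^ k * k.factorial * (Nat.doubleFactorial (2 * k - 1) : ℝ) := by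
    rcases k with _ | k
    · simp
    · have := Nat.factorial_eq_mul_doubleFactorial (2 * k + 1)
      rw [show 2 * k + 1 + 1 = 2 * (k + 1) by ring, Nat.doubleFactorial_two_mul] at this
      rw [this]
      push_cast
      rfl
  rw [h3, h4, h5]
  have : √2 ≠ 0 := by positivity
  have : √Real.pi ≠ 0 := by positivity
  field_simp
  rw [← mul_pow]
  norm_num

lemma gaussMoment_odd {k : ℕ} (hk : Odd k) : gaussMoment k = 0 := by
  have h : (gaussianReal 0 1).map (fun x => -x) = gaussianReal 0 1 := by
    simpa using gaussianReal_map_neg (μ := 0) (v := 1)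
  have h2 : gaussMoment k = - gaussMoment k := by
    conv_lhs => rw [gaussMoment, ← h]
    rw [integral_map (by fun_prop) (by fun_prop), gaussMoment, ← integral_neg]
    simp [hk.neg_pow]
  linarith

lemma mem_pairings_iff_cycleType {ι : Type*} [Fintype ι] [DecidableEq ι] {π : Equiv.Perm ι}
    {k : ℕ} (hk : Fintype.card ι = 2 * k) :
    π ∈ pairings ι ↔ π.cycleType = Multiset.replicate k 2 := by
  rw [mem_pairings]
  have hinv : (∀ t, π (π t) = t) ↔ π ^ 2 = 1 := by
    simp [Equiv.Perm.ext_iff, pow_two]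
  have hsupp : (∀ t, π t ≠ t) ↔ π.support = Finset.univ := by
    simp [Finset.eq_univ_iff_forall]
  rw [hinv, hsupp, ← Finset.card_eq_iff_eq_univ, hk]
  constructor
  · rintro ⟨h1, h2⟩
    have h3 := Equiv.Perm.cycleType_of_pow_prime_eq_one (p := 2) h1
    have h4 := π.sum_cycleType
    rw [h3] at h4 ⊢
    simp only [Multiset.sum_replicate, smul_eq_mul] at h4 ⊢
    congr 1
    lia
  · intro h
    have h4 := π.sum_cycleType
    refine ⟨Equiv.Perm.pow_prime_eq_one_iff.mpr fun c hc => ?_, ?_⟩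
    · rw [h] at hc
      exact Multiset.eq_of_mem_replicate hc
    · rw [← h4, h]
      simp [mul_comm]

lemma pairings_eq_empty {ι : Type*} [Fintype ι] [DecidableEq ι] (h : Odd (Fintype.card ι)) :
    pairings ι = ∅ := by
  rw [Finset.eq_empty_iff_forall_notMem]
  intro π hπ
  rw [mem_pairings] at hπ
  have h1 : π ^ 2 = 1 := by ext t; simpa [pow_two] using hπ.1 t
  have h2 := Equiv.Perm.two_dvd_card_support h1
  have h3 : π.support = Finset.univ := by
    simpa [Finset.eq_univ_iff_forall] using hπ.2
  rw [h3, Finset.card_univ] at h2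
  exact (Nat.not_even_iff_odd.mpr h) (even_iff_two_dvd.mpr h2)

/-- On `2k` points the fixed-point-free involutions form one conjugacy class, of size `(2k)! / (2^k
k!)`. In odd cardinality both sides vanish. -/
lemma card_pairings (ι : Type*) [Fintype ι] [DecidableEq ι] :
    ((pairings ι).card : ℝ) = gaussMoment (Fintype.card ι) := by
  rcases Nat.even_or_odd' (Fintype.card ι) with ⟨k, hk | hk⟩
  · have h1 : pairings ι = Finset.univ.filter
        (fun g : Equiv.Perm ι => g.cycleType = Multiset.replicate k 2) := by
      ext π
      simp [mem_pairings_iff_cycleType hk]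
    have h2 := Equiv.Perm.card_of_cycleType_mul_eq ι (Multiset.replicate k 2)
    rw [← h1, if_pos ⟨by simp [hk, mul_comm], fun a ha => (Multiset.eq_of_mem_replicate ha).ge⟩,
      hk] at h2
    have h3 : (pairings ι).card * (2 ^ k * k.factorial) = (2 * k).factorial := by
      rcases Nat.eq_zero_or_pos k with rfl | hk0
      · simpa using h2
      · simpa [Multiset.toFinset_replicate, hk0.ne', mul_comm k 2] using h2
    have h4 := gaussMoment_two_mul k
    rw [← h3] at h4
    rw [hk]
    push_cast at h4
    exact (mul_right_cancel₀ (by positivity) h4).symm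
  · have ho : Odd (Fintype.card ι) := ⟨k, hk⟩
    rw [pairings_eq_empty ho, gaussMoment_odd ho]
    simp

/-- A label-preserving pairing amounts to an independent choice of a pairing on each fibre of `e`.
-/
lemma card_pairings_filter {ι E : Type*} [Fintype ι] [DecidableEq ι] [Fintype E] [DecidableEq E]
    (e : ι → E) :
    ((pairings ι).filter fun π => ∀ t, e (π t) = e t).card =
      ∏ a, (pairings {t // e t = a}).card := by
  rw [← Fintype.card_piFinset]
  have mem (f : ∀ a, Equiv.Perm {t // e t = a}) {t : ι} {a : E} (h : e t = a) :
      DomMulAct.stabilizerEquiv_invFun_aux f t = f a ⟨t, h⟩ :=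
    DomMulAct.stabilizerEquiv_invFun_eq f h
  refine Finset.card_bij'
    (fun π hπ a => π.subtypePerm fun t => by
      rw [(Finset.mem_filter.mp hπ).2 t])
    (fun f _ => DomMulAct.stabilizerEquiv_invFun_aux f) ?_ ?_ ?_ ?_
  · intro π hπ
    simp only [Finset.mem_filter, mem_pairings] at hπ
    simp only [Fintype.mem_piFinset, mem_pairings]
    intro a
    refine ⟨fun t => Subtype.ext ?_, fun t ht => ?_⟩
    · simpa using hπ.1.1 t
    · exact hπ.1.2 t (by simpa using congrArg Subtype.val ht)
  · intro f hf
    simp only [Fintype.mem_piFinset, mem_pairings] at hf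
    simp only [Finset.mem_filter, mem_pairings]
    refine ⟨⟨fun t => ?_, fun t ht => ?_⟩, fun t => ?_⟩
    · rw [mem f (t := t) rfl, mem f (f (e t) ⟨t, rfl⟩).2]
      simpa using congrArg Subtype.val ((hf (e t)).1 ⟨t, rfl⟩)
    · rw [mem f (t := t) rfl] at ht
      exact (hf (e t)).2 ⟨t, rfl⟩ (Subtype.ext ht)
    · exact DomMulAct.comp_stabilizerEquiv_invFun f t
  · intro π hπ
    ext t
    rw [mem _ (t := t) rfl]
    simp
  · intro f hf
    ext a t
    simp [mem f t.2]

/-! ### Expectations of words in independent variables -/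

section Word

variable {Ω E ι : Type*} [MeasurableSpace Ω] {P : Measure Ω} [Fintype E] [DecidableEq E]
  [Fintype ι] {ξ : E → Ω → ℝ}

lemma prod_word_eq (x : E → ℝ) (e : ι → E) :
    ∏ t, x (e t) = ∏ a, x a ^ Fintype.card {t // e t = a} := by
  rw [← Finset.prod_fiberwise (s := Finset.univ) (g := e)]
  refine Finset.prod_congr rfl fun a _ => ?_
  rw [Fintype.card_subtype, ← Finset.prod_const]
  refine Finset.prod_congr rfl fun t ht => ?_
  rw [(Finset.mem_filter.mp ht).2]

lemma integral_prod_word (hm : ∀ a, Measurable (ξ a)) (hi : iIndepFun ξ P) (e : ι → E) :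
    ∫ ω, ∏ t, ξ (e t) ω ∂P = ∏ a, ∫ ω, ξ a ω ^ Fintype.card {t // e t = a} ∂P := by
  simp_rw [fun ω => prod_word_eq (fun a => ξ a ω) e]
  exact hi.integral_fun_prod_comp (f := fun a x => x ^ Fintype.card {t // e t = a})
    (fun a => (hm a).aemeasurable) (fun a => by fun_prop)

lemma integrable_prod_word (hm : ∀ a, Measurable (ξ a)) (hi : iIndepFun ξ P)
    (hint : ∀ a k, Integrable (fun ω => ξ a ω ^ k) P) (e : ι → E) :
    Integrable (fun ω => ∏ t, ξ (e t) ω) P := by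
  have := hi.isProbabilityMeasure
  simp_rw [fun ω => prod_word_eq (fun a => ξ a ω) e]
  have hprob (a : E) : IsProbabilityMeasure (P.map (ξ a)) :=
    Measure.isProbabilityMeasure_map (hm a).aemeasurable
  have h1 : Integrable (fun x : E → ℝ => ∏ a, x a ^ Fintype.card {t // e t = a})
      (Measure.pi fun a => P.map (ξ a)) :=
    Integrable.fintype_prod (f := fun a (x : ℝ) => x ^ Fintype.card {t // e t = a}) fun a =>
      (integrable_map_measure (by fun_prop) (hm a).aemeasurable).mpr (hint a _)
  rw [← hi.map_fun_eq_pi_map fun a => (hm a).aemeasurable] at h1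
  exact h1.comp_measurable (measurable_pi_lambda _ hm)

/-- Domination by `|x|^k ≤ 1 + x^(2k)`. -/
lemma integrable_pow_of_even [IsFiniteMeasure P] {f : Ω → ℝ} (hf : Measurable f)
    (h : ∀ p : ℕ, Integrable (fun ω => f ω ^ (2 * p)) P) (k : ℕ) :
    Integrable (fun ω => f ω ^ k) P := by
  refine ((integrable_const (1 : ℝ)).add (h k)).mono' (by fun_prop) (.of_forall fun ω => ?_)
  have : (f ω ^ k) ^ 2 = f ω ^ (2 * k) := by rw [← pow_mul, mul_comm]
  simp only [Pi.add_apply, Real.norm_eq_abs, ← this]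
  rw [← sq_abs (f ω ^ k)]
  nlinarith [sq_nonneg (|f ω ^ k| - 1), abs_nonneg (f ω ^ k)]

lemma integral_odd_pow_eq_zero {f : Ω → ℝ} (hf : Measurable f)
    (hs : P.map (fun ω => -f ω) = P.map f) {k : ℕ} (hk : Odd k) :
    ∫ ω, f ω ^ k ∂P = 0 := by
  have h1 : ∫ ω, f ω ^ k ∂P = ∫ x, x ^ k ∂(P.map f) :=
    (integral_map hf.aemeasurable (measurable_id.pow_const k).aestronglyMeasurable).symm
  have h2 : ∫ x, x ^ k ∂(P.map fun ω => -f ω) = ∫ ω, (-f ω) ^ k ∂P :=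
    integral_map (f := fun x : ℝ => x ^ k) (by fun_prop)
      (measurable_id.pow_const k).aestronglyMeasurable
  simp only [hk.neg_pow, integral_neg] at h2
  rw [hs, ← h1] at h2
  linarith

variable [DecidableEq ι]

/-- Both sides factor over the letters. Symmetry kills odd powers, and the Gaussian moment bounding
an even power counts the pairings of that letter's fibre; the factors are nonnegative, so the bounds
multiply. -/
lemma integral_prod_word_le (hm : ∀ a, Measurable (ξ a)) (hi : iIndepFun ξ P)
    (hs : ∀ a, P.map (fun ω => -ξ a ω) = P.map (ξ a))
    (hmom : ∀ a, ∀ p : ℕ, ∫ ω, ξ a ω ^ (2 * p) ∂P ≤ gaussMoment (2 * p)) (e : ι → E) :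
    ∫ ω, ∏ t, ξ (e t) ω ∂P ≤ ((pairings ι).filter fun π => ∀ t, e (π t) = e t).card := by
  rw [integral_prod_word hm hi, card_pairings_filter, Nat.cast_prod]
  refine Finset.prod_le_prod (fun a _ => ?_) fun a _ => ?_
  · rcases Nat.even_or_odd (Fintype.card {t // e t = a}) with h | h
    · exact integral_nonneg fun ω => h.pow_nonneg _
    · rw [integral_odd_pow_eq_zero (hm a) (hs a) h]
  · rw [card_pairings]
    rcases Nat.even_or_odd (Fintype.card {t // e t = a}) with h | h
    · obtain ⟨p, hp⟩ := h.two_dvd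
      rw [hp]
      exact hmom a p
    · rw [integral_odd_pow_eq_zero (hm a) (hs a) h, gaussMoment_odd h]

/-- Wick's formula. -/
lemma integral_prod_word_eq (hm : ∀ a, Measurable (ξ a)) (hi : iIndepFun ξ P) (e : ι → E)
    (hg : ∀ t, P.map (ξ (e t)) = gaussianReal 0 1) :
    ∫ ω, ∏ t, ξ (e t) ω ∂P = ((pairings ι).filter fun π => ∀ t, e (π t) = e t).card := by
  have := hi.isProbabilityMeasure
  rw [integral_prod_word hm hi, card_pairings_filter, Nat.cast_prod]
  refine Finset.prod_congr rfl fun a _ => ?_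
  rw [card_pairings]
  -- A letter absent from the word enters only through its zeroth moment, so its law is irrelevant.
  by_cases h : ∃ t, e t = a
  · obtain ⟨t, rfl⟩ := h
    rw [gaussMoment, ← hg t, integral_map (hm _).aemeasurable (by fun_prop)]
  · have : IsEmpty {t // e t = a} := ⟨fun t => h ⟨t, t.2⟩⟩
    simp [gaussMoment]

end Word

/-! ### Walks with a prescribed pattern of repetitions -/

section Walks

variable {α : Type*} [Fintype α]

lemma sum_snoc {N : ℕ} (G : (Fin (N + 1) → α) → ℝ) :
    ∑ x, G x = ∑ x : Fin N → α, ∑ a, G (Fin.snoc x a) := by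
  rw [← Fintype.sum_prod_type_right (f := fun y : α × (Fin N → α) => G (Fin.snoc y.2 y.1))]
  exact (Fintype.sum_equiv (Fin.snocEquiv fun _ => α) _ _ fun _ => rfl).symm

lemma pow_apply_eq_sum_walks [DecidableEq α] (M : Matrix α α ℝ) (N : ℕ) (a b : α) :
    (M ^ N) a b = ∑ x : Fin (N + 1) → α, if x 0 = a ∧ x (Fin.last N) = b then
      ∏ t : Fin N, M (x t.castSucc) (x t.succ) else 0 := by
  induction N generalizing b with
  | zero =>
    rw [← (Equiv.funUnique (Fin 1) α).symm.sum_comp]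
    simp only [pow_zero, Matrix.one_apply, Equiv.funUnique_symm_apply, uniqueElim_const,
      Finset.univ_eq_empty, Finset.prod_empty]
    rw [Finset.sum_eq_single a]
    · simp
    · intro c _ hc
      simp [hc]
    · simp
  | succ N ih =>
    rw [pow_succ, Matrix.mul_apply, sum_snoc]
    simp_rw [ih, Finset.sum_mul]
    rw [Finset.sum_comm]
    refine Finset.sum_congr rfl fun x _ => ?_
    have h0 (c : α) : (Fin.snoc x c : Fin (N + 1 + 1) → α) 0 = x 0 := by
      rw [← Fin.castSucc_zero, Fin.snoc_castSucc]
    simp only [h0, Fin.snoc_last]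
    rw [Finset.sum_eq_single (x (Fin.last N)), Finset.sum_eq_single b]
    · simp [Fin.prod_univ_castSucc, ← Fin.castSucc_succ, Fin.succ_last]
    · intro c _ hc
      simp [hc]
    · simp
    · intro c _ hc
      simp [hc.symm]
    · simp

variable (w : α → α → ℝ) (r : ℕ → ℕ) (A : ℕ → α → Prop)

/-- The product of the weights of the steps of a walk which lead to a new vertex, where `r t` is
the first time at which the vertex visited at time `t` was visited. -/
noncomputable def treeWeight {N : ℕ} (x : Fin (N + 1) → α) : ℝ :=
  ∏ t : Fin N, if r (t + 1) = t + 1 then w (x t.castSucc) (x t.succ) else 1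

/-- Walks which repeat vertices as prescribed by `r` and stay in the sets `A t`. -/
def IsTreeWalk {N : ℕ} (x : Fin (N + 1) → α) : Prop :=
  (∀ s t : Fin (N + 1), (s : ℕ) = r t → x s = x t) ∧ ∀ t : Fin (N + 1), A t (x t)

open Classical in
/-- The total weight of all tree walks of a given length. -/
noncomputable def treeSum (N : ℕ) : ℝ :=
  ∑ x : Fin (N + 1) → α, if IsTreeWalk r A x then treeWeight w r x else 0

omit [Fintype α] in
lemma treeWeight_snoc {N : ℕ} (x : Fin (N + 1) → α) (a : α) :
    treeWeight w r (Fin.snoc x a : Fin (N + 1 + 1) → α) =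
      treeWeight w r x * if r (N + 1) = N + 1 then w (x (Fin.last N)) a else 1 := by
  simp only [treeWeight]
  rw [Fin.prod_univ_castSucc]
  simp only [Fin.val_castSucc, Fin.val_last, Fin.snoc_castSucc, Fin.succ_last, Fin.snoc_last,
    ← Fin.castSucc_succ]

variable {r}

omit [Fintype α] in
-- Since `r` only looks backwards, removing the last vertex leaves a walk of the same kind. Keeping
-- `r` and `A` on all of `ℕ` lets the same data serve every length in the inductions below.
lemma isTreeWalk_snoc (hr : ∀ t, r t ≤ t) {N : ℕ} (x : Fin (N + 1) → α) (a : α) :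
    IsTreeWalk r A (Fin.snoc x a : Fin (N + 1 + 1) → α) ↔
      IsTreeWalk r A x ∧ (∀ s : Fin (N + 1), (s : ℕ) = r (N + 1) → x s = a) ∧ A (N + 1) a := by
  simp only [IsTreeWalk, Fin.forall_fin_succ' (n := N + 1), Fin.snoc_castSucc, Fin.snoc_last, Fin.val_castSucc,
    Fin.val_last]
  constructor
  · rintro ⟨⟨h1, h2⟩, h3, h4⟩
    exact ⟨⟨fun s => (h1 s).1, h3⟩, fun s => (h1 s).2, h4⟩
  · rintro ⟨⟨h1, h2⟩, h3, h4⟩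
    refine ⟨⟨fun s => ⟨h1 s, h3 s⟩, fun t ht => ?_, fun _ => trivial⟩, h2, h4⟩
    have := hr t
    have := t.2
    lia

variable {w A}

/-- The factor by which one step changes the total weight of tree walks. -/
noncomputable def stepFactor (r : ℕ → ℕ) (c : ℕ → ℝ) (N : ℕ) : ℝ :=
  if r (N + 1) = N + 1 then c (N + 1) else 1

open Classical in
lemma treeSum_succ (hr : ∀ t, r t ≤ t) (N : ℕ) :
    treeSum w r A (N + 1) = ∑ x : Fin (N + 1) → α, if IsTreeWalk r A x then
      treeWeight w r x * (∑ a, if (∀ s : Fin (N + 1), (s : ℕ) = r (N + 1) → x s = a) ∧ A (N + 1) a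
        then (if r (N + 1) = N + 1 then w (x (Fin.last N)) a else 1) else 0) else 0 := by
  rw [treeSum, sum_snoc]
  refine Finset.sum_congr rfl fun x _ => ?_
  simp only [isTreeWalk_snoc A hr, treeWeight_snoc]
  by_cases h : IsTreeWalk r A x
  · simp only [h, true_and, if_true, Finset.mul_sum, mul_ite, mul_zero]
  · simp [h]

omit [Fintype α] in
lemma treeWeight_nonneg (hw : ∀ a b, 0 ≤ w a b) {N : ℕ} (x : Fin (N + 1) → α) :
    0 ≤ treeWeight w r x := by
  refine Finset.prod_nonneg fun t _ => ?_
  split_ifs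
  exacts [hw _ _, zero_le_one]

open Classical in
lemma treeSum_zero (h0 : r 0 = 0) : treeSum w r A 0 = ((Finset.univ.filter (A 0)).card : ℝ) := by
  rw [treeSum, ← (Equiv.funUnique (Fin 1) α).symm.sum_comp]
  simp [IsTreeWalk, treeWeight, h0]

open Classical in
-- Sum out the last vertex: if its time is new, this costs at most `c`; if not, the vertex is
-- dictated by an earlier one, so at most one choice survives, with factor 1.
lemma treeSum_le (hr : ∀ t, r t ≤ t) (hw : ∀ a b, 0 ≤ w a b) {c : ℕ → ℝ}
    (hcn : ∀ t, 0 ≤ c t)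
    (hc : ∀ t a, A t a → ∑ b, (if A (t + 1) b then w a b else 0) ≤ c (t + 1)) (N : ℕ) :
    treeSum w r A N ≤
      ((Finset.univ.filter (A 0)).card : ℝ) * ∏ t ∈ Finset.range N, stepFactor r c t := by
  induction N with
  | zero => simp [treeSum_zero (A := A) (w := w) (Nat.le_zero.mp (hr 0))]
  | succ N ih =>
    have hc0 : treeSum w r A (N + 1) ≤ treeSum w r A N * stepFactor r c N := by
      rw [treeSum_succ hr, treeSum, Finset.sum_mul]
      refine Finset.sum_le_sum fun x _ => ?_
      by_cases hx : IsTreeWalk r A x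
      · rw [if_pos hx, if_pos hx]
        refine mul_le_mul_of_nonneg_left ?_ (treeWeight_nonneg hw x)
        rw [stepFactor]
        by_cases hnew : r (N + 1) = N + 1
        · simp only [if_pos hnew]
          refine le_trans (le_of_eq ?_) (hc N (x (Fin.last N)) (hx.2 (Fin.last N)))
          refine Finset.sum_congr rfl fun a _ => ?_
          congr 1
          rw [hnew, eq_iff_iff, and_iff_right_iff_imp]
          intro _ s hs
          have := s.2
          lia
        · have hlt : r (N + 1) < N + 1 := lt_of_le_of_ne (hr _) hnew
          simp only [if_neg hnew]
          rw [Finset.sum_eq_single (x ⟨r (N + 1), hlt⟩)]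
          · split_ifs <;> simp
          · intro b _ hb
            rw [if_neg]
            rintro ⟨h, -⟩
            exact hb (h ⟨r (N + 1), hlt⟩ rfl).symm
          · simp
      · simp [hx]
    rw [Finset.prod_range_succ, ← mul_assoc]
    refine hc0.trans (mul_le_mul_of_nonneg_right ih ?_)
    rw [stepFactor]
    split_ifs
    exacts [hcn _, zero_le_one]

open Classical in
-- In the equality case, `hA` guarantees that the vertex dictated at a repeated time is indeed
-- allowed there.
lemma treeSum_eq (hr : ∀ t, r t ≤ t) {c : ℕ → ℝ}
    (hA : ∀ t a, A (r t) a → A t a)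
    (hc : ∀ t a, A t a → ∑ b, (if A (t + 1) b then w a b else 0) = c (t + 1)) (N : ℕ) :
    treeSum w r A N =
      ((Finset.univ.filter (A 0)).card : ℝ) * ∏ t ∈ Finset.range N, stepFactor r c t := by
  induction N with
  | zero => simp [treeSum_zero (A := A) (w := w) (Nat.le_zero.mp (hr 0))]
  | succ N ih =>
    rw [Finset.prod_range_succ, ← mul_assoc, ← ih, treeSum_succ hr, treeSum, Finset.sum_mul]
    refine Finset.sum_congr rfl fun x _ => ?_
    by_cases hx : IsTreeWalk r A x
    · rw [if_pos hx, if_pos hx]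
      congr 1
      rw [stepFactor]
      by_cases hnew : r (N + 1) = N + 1
      · simp only [if_pos hnew]
        refine Eq.trans ?_ (hc N (x (Fin.last N)) (hx.2 (Fin.last N)))
        refine Finset.sum_congr rfl fun a _ => ?_
        congr 1
        rw [hnew, eq_iff_iff, and_iff_right_iff_imp]
        intro _ s hs
        have := s.2
        lia
      · have hlt : r (N + 1) < N + 1 := lt_of_le_of_ne (hr _) hnew
        simp only [if_neg hnew]
        rw [Finset.sum_eq_single (x ⟨r (N + 1), hlt⟩)]
        · rw [if_pos]
          exact ⟨fun s hs => congrArg x (Fin.ext hs), hA _ _ (hx.2 ⟨r (N + 1), hlt⟩)⟩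
        · intro b _ hb
          rw [if_neg]
          rintro ⟨h, -⟩
          exact hb (h ⟨r (N + 1), hlt⟩ rfl).symm
        · simp
    · simp [hx]

end Walks

/-! ### Identifications of times forced by a pairing -/

section EdgePairing

variable {N : ℕ} (π : Equiv.Perm (Fin N))

/-- The identification of times forced on a closed walk with `N` steps in a bipartite graph when
the steps `i` and `π i` use the same edge. -/
def edgeRel (s t : ℕ) : Prop :=
  (s = N ∧ t = 0) ∨ ∃ i : Fin N,
    if (i : ℕ) % 2 = (π i : ℕ) % 2 then (s = i ∧ t = π i) ∨ (s = i + 1 ∧ t = π i + 1)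
    else (s = i ∧ t = π i + 1) ∨ (s = i + 1 ∧ t = π i)

/-- The first time identified with a given time. -/
noncomputable def firstVisit (t : ℕ) : ℕ := sInf {s | Relation.EqvGen (edgeRel π) s t}

lemma firstVisit_le {s t : ℕ} (h : Relation.EqvGen (edgeRel π) s t) : firstVisit π t ≤ s :=
  Nat.sInf_le h

lemma firstVisit_le_self (t : ℕ) : firstVisit π t ≤ t := firstVisit_le π (.refl t)

lemma firstVisit_rel (t : ℕ) : Relation.EqvGen (edgeRel π) (firstVisit π t) t :=
  Nat.sInf_mem (s := {s | Relation.EqvGen (edgeRel π) s t}) ⟨t, .refl t⟩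

lemma firstVisit_eq {s t : ℕ} (h : edgeRel π s t) : firstVisit π s = firstVisit π t := by
  have h := Relation.EqvGen.rel _ _ h
  rw [firstVisit, firstVisit]
  congr 1
  ext u
  exact ⟨fun hu => hu.trans _ _ _ h, fun hu => hu.trans _ _ _ (h.symm)⟩

/-- Parity of time is the side of the bipartite graph. Only closing up the walk, which identifies
`N` with `0`, needs `N` even. -/
lemma edgeRel_mod_two (hN : Even N) {s t : ℕ} (h : Relation.EqvGen (edgeRel π) s t) :
    s % 2 = t % 2 := by
  induction h with
  | rel s t h =>
    rw [Nat.even_iff] at hN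
    rcases h with ⟨rfl, rfl⟩ | ⟨i, h⟩
    · lia
    · split_ifs at h <;> lia
  | refl => rfl
  | symm _ _ _ ih => exact ih.symm
  | trans _ _ _ _ _ ih1 ih2 => exact ih1.trans ih2

variable {π}

/-- If `π i` came before `i`, the arrival time `i + 1` would be identified with an endpoint of step
`π i`, that is, with a time at most `i`. -/
lemma lt_of_firstVisit_eq (hπ : π ∈ pairings (Fin N)) {i : Fin N}
    (h : firstVisit π (i + 1) = i + 1) : i < π i := by
  rw [mem_pairings] at hπ
  by_contra hlt
  have hlt : (π i : ℕ) < i := lt_of_le_of_ne (not_lt.mp hlt) fun h => hπ.2 i (Fin.ext h)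
  by_cases hp : (i : ℕ) % 2 = (π i : ℕ) % 2
  · have : edgeRel π (i + 1) (π i + 1) := Or.inr ⟨i, by rw [if_pos hp]; simp⟩
    have := firstVisit_le π (Relation.EqvGen.rel _ _ this).symm
    lia
  · have : edgeRel π (i + 1) (π i) := Or.inr ⟨i, by rw [if_neg hp]; simp⟩
    have := firstVisit_le π (Relation.EqvGen.rel _ _ this).symm
    lia

/-- `T` selects at most one element of each pair. A pair with a selected element contributes exactly
`B²`; every other factor is at most 1. -/
lemma prod_le_prod_sq_of_pairing {ι : Type*} [Fintype ι] [DecidableEq ι] [LinearOrder ι]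
    {π : Equiv.Perm ι} (hπ : ∀ i, π (π i) = i) (B : ι → ℝ) (h0 : ∀ i, 0 ≤ B i)
    (h1 : ∀ i, B i ≤ 1) (hB : ∀ i, B (π i) = B i) (T : ι → Prop) [DecidablePred T]
    (hT : ∀ i, T i → i < π i) :
    ∏ i, B i ≤ ∏ i, if T i then B i ^ 2 else 1 := by
  have h2 : ∏ i, (if T (π i) then B i else 1) = ∏ i, if T i then B i else 1 := by
    rw [← Equiv.prod_comp π fun i => if T i then B i else 1]
    simp only [hB]
  calc ∏ i, B i ≤ ∏ i, (if T i then B i else 1) * (if T (π i) then B i else 1) := by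
        refine Finset.prod_le_prod (fun i _ => h0 i) fun i _ => ?_
        by_cases hi : T i
        · have : ¬ T (π i) := fun h => by
            have h3 := hT _ h
            rw [hπ] at h3
            exact lt_asymm h3 (hT i hi)
          simp [hi, this]
        · by_cases hi' : T (π i) <;> simp [hi, hi', h1]
    _ = _ := by
        rw [Finset.prod_mul_distrib, h2, ← Finset.prod_mul_distrib]
        refine Finset.prod_congr rfl fun i _ => ?_
        split_ifs <;> ring

end EdgePairing

/-! ### The upper bound for a fixed pairing -/

section Bipartite

variable {n m : ℕ}

/-- The side of a vertex of the complete bipartite graph of row and column indices. -/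
def side : Fin n ⊕ Fin m → ℕ := Sum.elim (fun _ => 0) fun _ => 1

/-- The matrix position of an edge between a row index and a column index (and the junk value
`e₀` for two indices of the same kind). -/
def edgePos (e₀ : Fin n × Fin m) : Fin n ⊕ Fin m → Fin n ⊕ Fin m → Fin n × Fin m
  | .inl i, .inr j => (i, j)
  | .inr j, .inl i => (i, j)
  | _, _ => e₀

/-- The self-adjoint dilation of a matrix. -/
def dilation (b : Matrix (Fin n) (Fin m) ℝ) : Matrix (Fin n ⊕ Fin m) (Fin n ⊕ Fin m) ℝ :=
  Matrix.fromBlocks 0 b bᵀ 0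

/-- The parity of time fixes the direction in which an edge is crossed, so equal edges have
endpoints matched in order or swapped. The alternation of sides rules out the junk value. -/
lemma edgePos_eq_iff (e₀ : Fin n × Fin m) {a b a' b' : Fin n ⊕ Fin m} {s t : ℕ}
    (ha : side a = s % 2) (hb : side b = (s + 1) % 2)
    (ha' : side a' = t % 2) (hb' : side b' = (t + 1) % 2) :
    edgePos e₀ a b = edgePos e₀ a' b' ↔
      if s % 2 = t % 2 then a = a' ∧ b = b' else a = b' ∧ b = a' := by
  have hs := Nat.mod_two_eq_zero_or_one s
  have ht := Nat.mod_two_eq_zero_or_one t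
  rcases a with a | a <;> rcases b with b | b <;> rcases a' with a' | a' <;>
    rcases b' with b' | b' <;>
    simp only [side, Sum.elim_inl, Sum.elim_inr] at ha hb ha' hb' <;>
    first
    | (exfalso; lia)
    | (simp [edgePos, ← ha, ← ha', and_comm])

lemma side_ne_of_dilation_ne_zero {b : Matrix (Fin n) (Fin m) ℝ} {x y : Fin n ⊕ Fin m}
    (h : dilation b x y ≠ 0) : side y = (side x + 1) % 2 := by
  rcases x with x | x <;> rcases y with y | y <;> simp_all [dilation, side]

lemma dilation_nonneg {b : Matrix (Fin n) (Fin m) ℝ} (hb : ∀ i j, 0 ≤ b i j)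
    (x y : Fin n ⊕ Fin m) : 0 ≤ dilation b x y := by
  rcases x with x | x <;> rcases y with y | y <;> simp [dilation, hb]

lemma dilation_le_one {b : Matrix (Fin n) (Fin m) ℝ} (hb : ∀ i j, b i j ≤ 1)
    (x y : Fin n ⊕ Fin m) : dilation b x y ≤ 1 := by
  rcases x with x | x <;> rcases y with y | y <;> simp [dilation, hb]

lemma dilation_eq_of_edgePos (b : Matrix (Fin n) (Fin m) ℝ) (e₀ : Fin n × Fin m)
    {x y x' y' : Fin n ⊕ Fin m} (h : side x ≠ side y) (h' : side x' ≠ side y')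
    (he : edgePos e₀ x y = edgePos e₀ x' y') : dilation b x y = dilation b x' y' := by
  rcases x with x | x <;> rcases y with y | y <;> rcases x' with x' | x' <;>
    rcases y' with y' | y' <;> simp_all [dilation, side, edgePos]

variable {N : ℕ} {π : Equiv.Perm (Fin N)}

/-- Closed walks from a row index which use the same edge at paired steps. -/
def IsPairedWalk (e₀ : Fin n × Fin m) (π : Equiv.Perm (Fin N))
    (x : Fin (N + 1) → Fin n ⊕ Fin m) : Prop :=
  side (x 0) = 0 ∧ x 0 = x (Fin.last N) ∧
    ∀ i, edgePos e₀ (x (π i).castSucc) (x (π i).succ) = edgePos e₀ (x i.castSucc) (x i.succ)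

lemma side_eq_of_prod_ne_zero {b : Matrix (Fin n) (Fin m) ℝ} {x : Fin (N + 1) → Fin n ⊕ Fin m}
    (h0 : side (x 0) = 0) (h : ∏ i : Fin N, dilation b (x i.castSucc) (x i.succ) ≠ 0)
    (t : Fin (N + 1)) : side (x t) = (t : ℕ) % 2 := by
  induction t using Fin.induction with
  | zero => simpa using h0
  | succ i ih =>
    rw [side_ne_of_dilation_ne_zero (Finset.prod_ne_zero_iff.mp h i (Finset.mem_univ i)), ih]
    simp

/-- Capping times with `min` extends the walk to all of `ℕ`, so that the induction over chains of
identifications needs no range condition on intermediate times. -/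
lemma eq_of_edgeRel (e₀ : Fin n × Fin m) {x : Fin (N + 1) → Fin n ⊕ Fin m}
    (hx : IsPairedWalk e₀ π x) (hside : ∀ t : Fin (N + 1), side (x t) = (t : ℕ) % 2)
    {s t : ℕ} (h : Relation.EqvGen (edgeRel π) s t) :
    x ⟨min s N, by lia⟩ = x ⟨min t N, by lia⟩ := by
  have key (i : Fin N) := (edgePos_eq_iff e₀ (hside i.castSucc) (by simpa using hside i.succ)
    (hside (π i).castSucc) (by simpa using hside (π i).succ)).mp (hx.2.2 i).symm
  have h1 (i : Fin N) : x ⟨min i N, by lia⟩ = x i.castSucc :=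
    congrArg x (Fin.ext (min_eq_left i.2.le))
  have h2 (i : Fin N) : x ⟨min (i + 1) N, by lia⟩ = x i.succ :=
    congrArg x (Fin.ext (min_eq_left i.2))
  induction h with
  | rel s t h =>
    rcases h with ⟨rfl, rfl⟩ | ⟨i, h⟩
    · have h0 : x ⟨min 0 s, by lia⟩ = x 0 := congrArg x (Fin.ext (Nat.zero_min _))
      have hl : x ⟨min s s, by lia⟩ = x (Fin.last s) := congrArg x (Fin.ext (min_self s))
      rw [h0, hl, hx.2.1]
    · have := key i
      simp only [Fin.val_castSucc] at this
      split_ifs at h this <;> rcases h with ⟨rfl, rfl⟩ | ⟨rfl, rfl⟩ <;>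
        simp only [h1, h2, this]
  | refl => rfl
  | symm _ _ _ ih => exact ih.symm
  | trans _ _ _ _ _ ih1 ih2 => exact ih1.trans ih2

lemma IsPairedWalk.isTreeWalk {e₀ : Fin n × Fin m} {x : Fin (N + 1) → Fin n ⊕ Fin m}
    (hx : IsPairedWalk e₀ π x) (hside : ∀ t : Fin (N + 1), side (x t) = (t : ℕ) % 2) :
    IsTreeWalk (firstVisit π) (fun t a => side a = t % 2) x := by
  refine ⟨fun s t hst => ?_, hside⟩
  have h := eq_of_edgeRel e₀ hx hside (firstVisit_rel π t)
  rw [← hst] at h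
  have h1 (i : Fin (N + 1)) : x ⟨min i N, by lia⟩ = x i :=
    congrArg x (Fin.ext (min_eq_left (Nat.lt_succ_iff.mp i.2)))
  rwa [h1, h1] at h

lemma IsPairedWalk.prod_le_treeWeight {e₀ : Fin n × Fin m} {x : Fin (N + 1) → Fin n ⊕ Fin m}
    (hπ : π ∈ pairings (Fin N)) {b : Matrix (Fin n) (Fin m) ℝ} (hb0 : ∀ i j, 0 ≤ b i j)
    (hb1 : ∀ i j, b i j ≤ 1)
    (hx : IsPairedWalk e₀ π x) (hside : ∀ t : Fin (N + 1), side (x t) = (t : ℕ) % 2) :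
    ∏ i : Fin N, dilation b (x i.castSucc) (x i.succ) ≤
      treeWeight (fun a a' => dilation b a a' ^ 2) (firstVisit π) x := by
  have hne (i : Fin N) : side (x i.castSucc) ≠ side (x i.succ) := by
    rw [hside, hside, Fin.val_castSucc, Fin.val_succ]
    lia
  exact prod_le_prod_sq_of_pairing (mem_pairings.mp hπ).1
    (fun i : Fin N => dilation b (x i.castSucc) (x i.succ))
    (fun i => dilation_nonneg hb0 _ _) (fun i => dilation_le_one hb1 _ _)
    (fun i => dilation_eq_of_edgePos b e₀ (hne _) (hne _) (hx.2.2 i))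
    (fun i => firstVisit π (i + 1) = i + 1) (fun i hi => lt_of_firstVisit_eq hπ hi)

open Classical in
/-- The total weight of the walks which use the same edge at paired steps. -/
noncomputable def pairedSum (e₀ : Fin n × Fin m) (b : Matrix (Fin n) (Fin m) ℝ)
    (π : Equiv.Perm (Fin N)) : ℝ :=
  ∑ x : Fin (N + 1) → Fin n ⊕ Fin m, if IsPairedWalk e₀ π x then
    ∏ i : Fin N, dilation b (x i.castSucc) (x i.succ) else 0

lemma card_side_zero [DecidableEq (Fin n ⊕ Fin m)] :
    (Finset.univ.filter fun a : Fin n ⊕ Fin m => side a = 0).card = n := by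
  have : (Finset.univ.filter fun a : Fin n ⊕ Fin m => side a = 0) =
      Finset.univ.map ⟨Sum.inl, Sum.inl_injective⟩ := by
    ext a
    simp only [Finset.mem_filter, Finset.mem_univ, true_and, Finset.mem_map]
    rcases a with a | a <;> simp [side]
  rw [this]
  simp

/-- The alternating bounds for the row sums of the dilation. -/
def altBound (d₁ d₂ : ℕ) (t : ℕ) : ℝ := if t % 2 = 0 then d₁ else d₂

/-- A paired walk of nonzero weight alternates sides, hence is a tree walk, and its weight is at
most its tree weight. Then `treeSum_le` applies, with the squared column and row sums as step
bounds. -/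
lemma pairedSum_le (e₀ : Fin n × Fin m) (hπ : π ∈ pairings (Fin N))
    {b : Matrix (Fin n) (Fin m) ℝ} (hb0 : ∀ i j, 0 ≤ b i j) (hb1 : ∀ i j, b i j ≤ 1)
    {d₁ d₂ : ℕ} (h1 : ∀ j, ∑ i, b i j ^ 2 ≤ d₁) (h2 : ∀ i, ∑ j, b i j ^ 2 ≤ d₂) :
    pairedSum e₀ b π ≤
      n * ∏ t ∈ Finset.range N, stepFactor (firstVisit π) (altBound d₁ d₂) t := by
  classical
  have h3 : pairedSum e₀ b π ≤ treeSum (fun a a' => dilation b a a' ^ 2) (firstVisit π)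
      (fun t a => side a = t % 2) N := by
    refine Finset.sum_le_sum fun x _ => ?_
    have h0 : 0 ≤ treeWeight (fun a a' => dilation b a a' ^ 2) (firstVisit π) x :=
      treeWeight_nonneg (fun _ _ => sq_nonneg _) x
    by_cases hx : IsPairedWalk e₀ π x
    · rw [if_pos hx]
      by_cases hp : ∏ i : Fin N, dilation b (x i.castSucc) (x i.succ) = 0
      · rw [hp]
        split_ifs
        exacts [h0, le_rfl]
      · have hside := side_eq_of_prod_ne_zero hx.1 hp
        rw [if_pos (hx.isTreeWalk hside)]
        exact hx.prod_le_treeWeight hπ hb0 hb1 hside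
    · rw [if_neg hx]
      split_ifs
      exacts [h0, le_rfl]
  refine h3.trans ((treeSum_le (c := altBound d₁ d₂) (firstVisit_le_self π)
    (fun _ _ => sq_nonneg _) ?_ ?_ N).trans_eq ?_)
  · intro t
    rw [altBound]
    split_ifs <;> positivity
  · intro t a ha
    rw [altBound]
    rcases a with i | j
    · simp only [side, Sum.elim_inl] at ha
      rw [if_neg (by lia)]
      have : (t + 1) % 2 = 1 := by lia
      simpa [Fintype.sum_sum_type, side, this, dilation] using h2 i
    · simp only [side, Sum.elim_inr] at ha
      have : (t + 1) % 2 = 0 := by lia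
      simpa [Fintype.sum_sum_type, side, this, dilation] using h1 j
  · simp only [Nat.zero_mod]
    rw [card_side_zero]

end Bipartite

/-! ### The block matrix attains the bound -/

section Block

variable {n m : ℕ}

/-- The coefficients of the block-diagonal matrix. -/
def blockCoeff (n m d₁ d₂ : ℕ) : Matrix (Fin n) (Fin m) ℝ :=
  fun i j => if (i : ℕ) / d₁ = (j : ℕ) / d₂ then 1 else 0

lemma blockCoeff_nonneg (d₁ d₂ : ℕ) (i : Fin n) (j : Fin m) : 0 ≤ blockCoeff n m d₁ d₂ i j := by
  rw [blockCoeff]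
  split_ifs <;> norm_num

/-- The block to which a row or column index belongs. -/
def blockOf (d₁ d₂ : ℕ) : Fin n ⊕ Fin m → ℕ := Sum.elim (fun i => i / d₁) fun j => j / d₂

lemma dilation_blockCoeff (d₁ d₂ : ℕ) {a b : Fin n ⊕ Fin m} (h : side a ≠ side b) :
    dilation (blockCoeff n m d₁ d₂) a b = if blockOf d₁ d₂ a = blockOf d₁ d₂ b then 1 else 0 := by
  rcases a with a | a <;> rcases b with b | b <;>
    simp_all [side, dilation, blockCoeff, blockOf, eq_comm] <;> rfl

lemma card_filter_div_eq {N d k : ℕ} (hd : 0 < d) (h : (k + 1) * d ≤ N) :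
    (Finset.univ.filter fun j : Fin N => (j : ℕ) / d = k).card = d := by
  have : (Finset.univ.filter fun j : Fin N => (j : ℕ) / d = k).map Fin.valEmbedding =
      Finset.Ico (k * d) ((k + 1) * d) := by
    ext j
    simp only [Finset.mem_map, Finset.mem_filter, Finset.mem_univ, true_and, Finset.mem_Ico,
      Fin.valEmbedding_apply]
    have key : j / d = k ↔ k * d ≤ j ∧ j < (k + 1) * d := by
      rw [Nat.div_eq_iff hd, add_mul]
      lia
    constructor
    · rintro ⟨j, hj, rfl⟩
      exact key.mp hj
    · intro hj
      exact ⟨⟨j, hj.2.trans_le h⟩, key.mpr hj, rfl⟩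
  rw [← Finset.card_map Fin.valEmbedding, this, Nat.card_Ico, add_mul, one_mul,
    Nat.add_sub_cancel_left]

lemma div_mul_le_of_ratio {d₁ d₂ : ℕ} (hd₁ : 0 < d₁) (hd₂ : 0 < d₂) (hdvd : d₁ ∣ n)
    (hratio : (n : ℝ) / (d₁ : ℝ) ≤ (m : ℝ) / (d₂ : ℝ)) : n / d₁ * d₂ ≤ m := by
  rw [le_div_iff₀ (by positivity), ← Nat.cast_div hdvd (by positivity)] at hratio
  exact_mod_cast hratio

lemma sum_row_blockCoeff {d₁ d₂ : ℕ} (hd₂ : 0 < d₂) (hdvd : d₁ ∣ n)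
    (hm : n / d₁ * d₂ ≤ m) (i : Fin n) : ∑ j, blockCoeff n m d₁ d₂ i j ^ 2 = d₂ := by
  have hi : (i : ℕ) / d₁ < n / d₁ := Nat.div_lt_div_of_lt_of_dvd hdvd i.2
  have h : ((i : ℕ) / d₁ + 1) * d₂ ≤ m := (Nat.mul_le_mul_right _ hi).trans hm
  simp [blockCoeff, ite_pow, eq_comm (a := (i : ℕ) / d₁), card_filter_div_eq hd₂ h]

lemma sum_col_blockCoeff {d₁ d₂ : ℕ} (hd₁ : 0 < d₁) (j : Fin m)
    (hj : (j : ℕ) / d₂ < n / d₁) : ∑ i, blockCoeff n m d₁ d₂ i j ^ 2 = d₁ := by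
  have h : ((j : ℕ) / d₂ + 1) * d₁ ≤ n :=
    (Nat.mul_le_mul_right _ hj).trans (Nat.div_mul_le_self n d₁)
  simp [blockCoeff, ite_pow, card_filter_div_eq hd₁ h]

lemma sum_col_blockCoeff_le {d₁ d₂ : ℕ} (hd₁ : 0 < d₁) (hdvd : d₁ ∣ n) (j : Fin m) :
    ∑ i, blockCoeff n m d₁ d₂ i j ^ 2 ≤ d₁ := by
  by_cases hj : (j : ℕ) / d₂ < n / d₁
  · exact (sum_col_blockCoeff hd₁ j hj).le
  · rw [Finset.sum_eq_zero]
    · positivity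
    · intro i _
      have hi : (i : ℕ) / d₁ < n / d₁ := Nat.div_lt_div_of_lt_of_dvd hdvd i.2
      rw [blockCoeff, if_neg (by lia)]
      simp

variable {N : ℕ} {π : Equiv.Perm (Fin N)}

/-- Converse of `IsPairedWalk.isTreeWalk`: identified times share their first visit, hence their
vertex. -/
lemma IsTreeWalk.isPairedWalk (e₀ : Fin n × Fin m) {x : Fin (N + 1) → Fin n ⊕ Fin m}
    (hx : IsTreeWalk (firstVisit π) (fun t a => side a = t % 2) x) : IsPairedWalk e₀ π x := by
  have hrel {s t : Fin (N + 1)} (h : edgeRel π s t) : x s = x t := by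
    have h1 := firstVisit_le_self π s
    have hlt : firstVisit π s < N + 1 := by have := s.2; lia
    rw [← hx.1 ⟨firstVisit π s, hlt⟩ s rfl, hx.1 ⟨firstVisit π s, hlt⟩ t (firstVisit_eq π h)]
  refine ⟨hx.2 0, (hrel (Or.inl ⟨rfl, rfl⟩)).symm, fun i => Eq.symm ?_⟩
  rw [edgePos_eq_iff e₀ (hx.2 i.castSucc) (hx.2 i.succ) (hx.2 (π i).castSucc) (hx.2 (π i).succ)]
  simp only [Fin.val_castSucc]
  split_ifs with h
  · exact ⟨hrel (Or.inr ⟨i, by rw [if_pos h]; simp⟩), hrel (Or.inr ⟨i, by rw [if_pos h]; simp⟩)⟩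
  · exact ⟨hrel (Or.inr ⟨i, by rw [if_neg h]; simp⟩), hrel (Or.inr ⟨i, by rw [if_neg h]; simp⟩)⟩

/-- A new step has a nonzero coefficient, so it stays in the block; any other step returns to an
earlier vertex. -/
lemma blockOf_eq_of_treeWeight_ne_zero {d₁ d₂ : ℕ} {x : Fin (N + 1) → Fin n ⊕ Fin m}
    (hx : IsTreeWalk (firstVisit π) (fun t a => side a = t % 2) x)
    (h : treeWeight (fun a b => dilation (blockCoeff n m d₁ d₂) a b ^ 2) (firstVisit π) x ≠ 0)
    (t : ℕ) (ht : t < N + 1) : blockOf d₁ d₂ (x ⟨t, ht⟩) = blockOf d₁ d₂ (x 0) := by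
  induction t using Nat.strong_induction_on with
  | _ t ih =>
    rcases t with _ | t
    · rfl
    · by_cases hnew : firstVisit π (t + 1) = t + 1
      · have h1 := Finset.prod_ne_zero_iff.mp h ⟨t, by lia⟩ (Finset.mem_univ _)
        rw [if_pos hnew] at h1
        change dilation _ _ _ ^ 2 ≠ 0 at h1
        rw [dilation_blockCoeff] at h1
        · have h2 : blockOf d₁ d₂ (x ⟨t, by lia⟩) = blockOf d₁ d₂ (x ⟨t + 1, ht⟩) := by
            by_contra h2
            exact h1 (by simp [h2])
          rw [← h2, ih t (by lia)]
        · rw [hx.2, hx.2, Fin.val_castSucc, Fin.val_succ]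
          lia
      · have hlt := lt_of_le_of_ne (firstVisit_le_self π (t + 1)) hnew
        rw [← hx.1 ⟨firstVisit π (t + 1), hlt.trans ht⟩ ⟨t + 1, ht⟩ rfl]
        exact ih _ hlt _

/-- If the tree weight is nonzero, the walk lies in one block, where every coefficient is 1, and
both sides equal 1. -/
lemma treeWeight_blockCoeff_le {d₁ d₂ : ℕ} {x : Fin (N + 1) → Fin n ⊕ Fin m}
    (hx : IsTreeWalk (firstVisit π) (fun t a => side a = t % 2) x) :
    treeWeight (fun a b => dilation (blockCoeff n m d₁ d₂) a b ^ 2) (firstVisit π) x ≤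
      ∏ i : Fin N, dilation (blockCoeff n m d₁ d₂) (x i.castSucc) (x i.succ) := by
  have hne (i : Fin N) : side (x i.castSucc) ≠ side (x i.succ) := by
    rw [hx.2, hx.2, Fin.val_castSucc, Fin.val_succ]
    lia
  by_cases h : treeWeight (fun a b => dilation (blockCoeff n m d₁ d₂) a b ^ 2)
      (firstVisit π) x = 0
  · rw [h]
    exact Finset.prod_nonneg fun i _ => dilation_nonneg (blockCoeff_nonneg d₁ d₂) _ _
  · have hb := blockOf_eq_of_treeWeight_ne_zero hx h
    have h1 (i : Fin N) : dilation (blockCoeff n m d₁ d₂) (x i.castSucc) (x i.succ) = 1 := by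
      rw [dilation_blockCoeff _ _ (hne i), if_pos]
      exact (hb _ i.castSucc.2).trans (hb _ i.succ.2).symm
    rw [treeWeight]
    simp [h1]

lemma le_pairedSum_blockCoeff (e₀ : Fin n × Fin m) (hN : Even N) {d₁ d₂ : ℕ} (hd₁ : 0 < d₁)
    (hd₂ : 0 < d₂) (hdvd : d₁ ∣ n) (hm : n / d₁ * d₂ ≤ m) :
    n * ∏ t ∈ Finset.range N, stepFactor (firstVisit π) (altBound d₁ d₂) t ≤
      pairedSum e₀ (blockCoeff n m d₁ d₂) π := by
  classical
  have hrow (i : Fin n) : (i : ℕ) / d₁ < n / d₁ := Nat.div_lt_div_of_lt_of_dvd hdvd i.2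
  have h := treeSum_eq (c := altBound d₁ d₂)
    (w := fun a b => dilation (blockCoeff n m d₁ d₂) a b ^ 2)
    -- Columns beyond the last block have sum 0 instead of `d₁`, so the exact count is made among
    -- vertices of the `n / d₁` genuine blocks. Discarding the other walks only lowers the sum.
    (A := fun t a => side a = t % 2 ∧ blockOf d₁ d₂ a < n / d₁) (firstVisit_le_self π)
    (fun t a ha => ⟨ha.1.trans (edgeRel_mod_two π hN (firstVisit_rel π t)), ha.2⟩) ?_ N
  · have hcard (S : Finset (Fin n ⊕ Fin m))
        (hS : ∀ a, a ∈ S ↔ side a = 0 ∧ blockOf d₁ d₂ a < n / d₁) : S.card = n := by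
      refine Eq.trans ?_ (card_side_zero (n := n) (m := m))
      refine congrArg Finset.card (Finset.ext fun a => ?_)
      rw [hS, Finset.mem_filter]
      rcases a with a | a <;> simp [side, blockOf, hrow]
    rw [hcard _ (by simp)] at h
    rw [← h]
    refine Finset.sum_le_sum fun x _ => ?_
    have hn0 : 0 ≤ ∏ i : Fin N, dilation (blockCoeff n m d₁ d₂) (x i.castSucc) (x i.succ) :=
      Finset.prod_nonneg fun i _ => dilation_nonneg (blockCoeff_nonneg d₁ d₂) _ _
    by_cases hx : IsTreeWalk (firstVisit π)
        (fun t a => side a = t % 2 ∧ blockOf d₁ d₂ a < n / d₁) x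
    · have hx' : IsTreeWalk (firstVisit π) (fun t a => side a = t % 2) x :=
        ⟨hx.1, fun t => (hx.2 t).1⟩
      rw [if_pos hx, if_pos (hx'.isPairedWalk e₀)]
      exact treeWeight_blockCoeff_le hx'
    · rw [if_neg hx]
      split_ifs
      exacts [hn0, le_rfl]
  · rintro t (i | j) ⟨ha, hb⟩
    · simp only [side, Sum.elim_inl] at ha
      have h1 : (t + 1) % 2 = 1 := by lia
      rw [altBound, if_neg (by lia), ← sum_row_blockCoeff hd₂ hdvd hm i]
      simp only [Fintype.sum_sum_type, side, h1, Sum.elim_inl, Sum.elim_inr, zero_ne_one,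
        false_and, if_false, Finset.sum_const_zero, zero_add, true_and, dilation,
        Matrix.fromBlocks_apply₁₂, blockOf]
      refine Finset.sum_congr rfl fun j _ => ?_
      have := hrow i
      rw [blockCoeff]
      split_ifs <;> first | rfl | (simp; done) | (exfalso; lia)
    · simp only [side, Sum.elim_inr] at ha
      have h1 : (t + 1) % 2 = 0 := by lia
      rw [altBound, if_pos h1, ← sum_col_blockCoeff hd₁ j hb]
      simp [Fintype.sum_sum_type, side, h1, dilation, blockOf, hrow]

end Block

/-! ### Trace moments as sums over walks and pairings -/

section Trace

variable {Ω : Type*} {n m : ℕ}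

/-- The square of the dilation is block diagonal with upper left block `M Mᵀ`. -/
lemma trace_pow_eq_sum_dilation (M : Matrix (Fin n) (Fin m) ℝ) (p : ℕ) :
    ((M * Mᴴ) ^ p).trace = ∑ i : Fin n, (dilation M ^ (2 * p)) (.inl i) (.inl i) := by
  rw [pow_mul, dilation, pow_two, Matrix.fromBlocks_multiply]
  simp only [zero_mul, Matrix.mul_zero, Matrix.zero_mul, zero_add, add_zero,
    Matrix.fromBlocks_diagonal_pow, Matrix.fromBlocks_apply₁₁,
    Matrix.conjTranspose_eq_transpose_of_trivial]
  rfl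

open Classical in
lemma trace_pow_eq_sum_walks (M : Matrix (Fin n) (Fin m) ℝ) (p : ℕ) :
    ((M * Mᴴ) ^ p).trace = ∑ x : Fin (2 * p + 1) → Fin n ⊕ Fin m,
      if side (x 0) = 0 ∧ x 0 = x (Fin.last _) then
        ∏ t : Fin (2 * p), dilation M (x t.castSucc) (x t.succ) else 0 := by
  rw [trace_pow_eq_sum_dilation]
  simp_rw [pow_apply_eq_sum_walks]
  rw [Finset.sum_comm]
  refine Finset.sum_congr rfl fun x _ => ?_
  rcases h : x 0 with i | j
  · rw [Finset.sum_eq_single i]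
    · simp [side, eq_comm]
    · intro b _ hb
      simp [hb.symm]
    · simp
  · simp [side]

lemma dilation_entrywise_mul (e₀ : Fin n × Fin m) {M b : Matrix (Fin n) (Fin m) ℝ}
    {y : Fin n × Fin m → ℝ} (h : ∀ i j, M i j = b i j * y (i, j)) (u v : Fin n ⊕ Fin m) :
    dilation M u v = dilation b u v * y (edgePos e₀ u v) := by
  rcases u with u | u <;> rcases v with v | v <;> simp [dilation, edgePos, h]

variable [MeasurableSpace Ω] {P : Measure Ω} {X : Ω → Matrix (Fin n) (Fin m) ℝ}
  {b : Matrix (Fin n) (Fin m) ℝ} {ξ : Fin n × Fin m → Ω → ℝ}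

omit [MeasurableSpace Ω] in
open Classical in
lemma tracePow_eq (e₀ : Fin n × Fin m) (hX : ∀ ω i j, X ω i j = b i j * ξ (i, j) ω) (p : ℕ) :
    tracePow X p = fun ω => ∑ x : Fin (2 * p + 1) → Fin n ⊕ Fin m,
      (if side (x 0) = 0 ∧ x 0 = x (Fin.last _) then
        ∏ t : Fin (2 * p), dilation b (x t.castSucc) (x t.succ) else 0) *
          ∏ t : Fin (2 * p), ξ (edgePos e₀ (x t.castSucc) (x t.succ)) ω := by
  ext ω
  rw [tracePow, trace_pow_eq_sum_walks]
  refine Finset.sum_congr rfl fun x _ => ?_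
  rw [ite_mul, zero_mul, ← Finset.prod_mul_distrib]
  simp_rw [dilation_entrywise_mul e₀ (y := fun e => ξ e ω) (hX ω)]

lemma integrable_tracePow (e₀ : Fin n × Fin m) (hm : ∀ e, Measurable (ξ e)) (hi : iIndepFun ξ P)
    (hint : ∀ e k, Integrable (fun ω => ξ e ω ^ k) P)
    (hX : ∀ ω i j, X ω i j = b i j * ξ (i, j) ω) (p : ℕ) : Integrable (tracePow X p) P := by
  classical
  rw [tracePow_eq e₀ hX]
  exact integrable_finsetSum _ fun x _ => (integrable_prod_word hm hi hint _).const_mul _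

open Classical in
lemma integral_tracePow (e₀ : Fin n × Fin m) (hm : ∀ e, Measurable (ξ e)) (hi : iIndepFun ξ P)
    (hint : ∀ e k, Integrable (fun ω => ξ e ω ^ k) P)
    (hX : ∀ ω i j, X ω i j = b i j * ξ (i, j) ω) (p : ℕ) :
    ∫ ω, tracePow X p ω ∂P = ∑ x : Fin (2 * p + 1) → Fin n ⊕ Fin m,
      (if side (x 0) = 0 ∧ x 0 = x (Fin.last _) then
        ∏ t : Fin (2 * p), dilation b (x t.castSucc) (x t.succ) else 0) *
          ∫ ω, ∏ t : Fin (2 * p), ξ (edgePos e₀ (x t.castSucc) (x t.succ)) ω ∂P := by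
  rw [tracePow_eq e₀ hX, integral_finsetSum]
  · simp_rw [integral_const_mul]
  · exact fun x _ => (integrable_prod_word hm hi hint _).const_mul _

open Classical in
lemma sum_pairedSum (e₀ : Fin n × Fin m) (b : Matrix (Fin n) (Fin m) ℝ) (N : ℕ) :
    ∑ π ∈ pairings (Fin N), pairedSum e₀ b π = ∑ x : Fin (N + 1) → Fin n ⊕ Fin m,
      (if side (x 0) = 0 ∧ x 0 = x (Fin.last _) then
        ∏ t : Fin N, dilation b (x t.castSucc) (x t.succ) else 0) *
          (((pairings (Fin N)).filter fun π => ∀ t,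
            edgePos e₀ (x (π t).castSucc) (x (π t).succ) =
              edgePos e₀ (x t.castSucc) (x t.succ)).card : ℝ) := by
  simp only [pairedSum]
  rw [Finset.sum_comm]
  refine Finset.sum_congr rfl fun x _ => ?_
  rw [Finset.card_filter, Nat.cast_sum, Finset.mul_sum]
  refine Finset.sum_congr rfl fun π _ => ?_
  have hiff : IsPairedWalk e₀ π x ↔ (side (x 0) = 0 ∧ x 0 = x (Fin.last N)) ∧ ∀ t,
      edgePos e₀ (x (π t).castSucc) (x (π t).succ) = edgePos e₀ (x t.castSucc) (x t.succ) :=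
    and_assoc.symm
  by_cases h : IsPairedWalk e₀ π x
  · have h' := hiff.mp h
    rw [if_pos h, if_pos h'.1, if_pos h'.2, Nat.cast_one, mul_one]
  · rw [if_neg h]
    by_cases h1 : side (x 0) = 0 ∧ x 0 = x (Fin.last N)
    · rw [if_neg fun h2 => h (hiff.mpr ⟨h1, h2⟩), Nat.cast_zero, mul_zero]
    · rw [if_neg h1, zero_mul]

lemma integral_tracePow_le (e₀ : Fin n × Fin m) (hb : ∀ i j, 0 ≤ b i j)
    (hm : ∀ e, Measurable (ξ e)) (hi : iIndepFun ξ P)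
    (hint : ∀ e k, Integrable (fun ω => ξ e ω ^ k) P)
    (hs : ∀ e, P.map (fun ω => -ξ e ω) = P.map (ξ e))
    (hmom : ∀ e, ∀ p : ℕ, ∫ ω, ξ e ω ^ (2 * p) ∂P ≤ gaussMoment (2 * p))
    (hX : ∀ ω i j, X ω i j = b i j * ξ (i, j) ω) (p : ℕ) :
    ∫ ω, tracePow X p ω ∂P ≤ ∑ π ∈ pairings (Fin (2 * p)), pairedSum e₀ b π := by
  classical
  rw [integral_tracePow e₀ hm hi hint hX, sum_pairedSum]
  refine Finset.sum_le_sum fun x _ => mul_le_mul_of_nonneg_left ?_ ?_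
  · refine (integral_prod_word_le hm hi hs hmom
      fun t : Fin (2 * p) => edgePos e₀ (x t.castSucc) (x t.succ)).trans_eq ?_
    congr!
  · split_ifs
    exacts [Finset.prod_nonneg fun t _ => dilation_nonneg hb _ _, le_rfl]

/-- Walks of zero weight do not matter, so only the entries with nonzero coefficient have to be
Gaussian. -/
lemma integral_tracePow_eq (e₀ : Fin n × Fin m)
    (hm : ∀ e, Measurable (ξ e)) (hi : iIndepFun ξ P)
    (hint : ∀ e k, Integrable (fun ω => ξ e ω ^ k) P)
    (hg : ∀ i j, b i j ≠ 0 → P.map (ξ (i, j)) = gaussianReal 0 1)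
    (hX : ∀ ω i j, X ω i j = b i j * ξ (i, j) ω) (p : ℕ) :
    ∫ ω, tracePow X p ω ∂P = ∑ π ∈ pairings (Fin (2 * p)), pairedSum e₀ b π := by
  classical
  rw [integral_tracePow e₀ hm hi hint hX, sum_pairedSum]
  refine Finset.sum_congr rfl fun x _ => ?_
  by_cases h : ∏ t : Fin (2 * p), dilation b (x t.castSucc) (x t.succ) = 0
  · simp [h]
  · congr 1
    rw [integral_prod_word_eq hm hi
      (fun t : Fin (2 * p) => edgePos e₀ (x t.castSucc) (x t.succ)) fun t => ?_]
    · congr!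
    · have h1 := Finset.prod_ne_zero_iff.mp h t (Finset.mem_univ t)
      rcases hu : x t.castSucc with i | i <;> rcases hv : x t.succ with j | j <;>
        simp [hu, hv, dilation] at h1 <;> exact hg _ _ h1

end Trace

/-! ### Existence and admissibility of the block Gaussian matrix -/

section Model

variable {Ω : Type*} [MeasurableSpace Ω] {P : Measure Ω} {n m d₁ d₂ : ℕ}

/-- A preimage under a zero variable is empty or everything: it makes both sides vanish or drops out
of both. -/
lemma iIndepFun_of_subtype_of_const {E : Type*} {f : E → Ω → ℝ} {S : E → Prop}
    [IsProbabilityMeasure P]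
    (h : iIndepFun (fun (e : {e // S e}) => f e) P) (hc : ∀ e, ¬ S e → ∀ ω, f e ω = 0) :
    iIndepFun f P := by
  classical
  rw [iIndepFun_iff_measure_inter_preimage_eq_mul] at h ⊢
  intro F B hB
  by_cases h0 : ∃ e ∈ F, ¬ S e ∧ (0 : ℝ) ∉ B e
  · obtain ⟨e, he, hS, h0⟩ := h0
    have hempty : f e ⁻¹' B e = ∅ := by
      ext ω
      simp [hc e hS, h0]
    rw [Finset.prod_eq_zero he (by rw [hempty, measure_empty])]
    refine measure_mono_null (Set.biInter_subset_of_mem he) ?_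
    rw [hempty, measure_empty]
  · push Not at h0
    have huniv (e : E) (he : e ∈ F) (hS : ¬ S e) : f e ⁻¹' B e = Set.univ := by
      ext ω
      simp [hc e hS, h0 e he hS]
    have key := h (F.subtype S) (sets := fun e => B e)
      fun e he => hB e (Finset.mem_subtype.mp he)
    have h1 : ⋂ e ∈ F, f e ⁻¹' B e = ⋂ e ∈ F.subtype S, f (e : E) ⁻¹' B e := by
      ext ω
      simp only [Set.mem_iInter, Finset.mem_subtype, Subtype.forall]
      constructor
      · exact fun hω e _ he => hω e he
      · intro hω e he
        by_cases hS : S e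
        · exact hω e hS he
        · rw [huniv e he hS]
          trivial
    rw [h1, key, Finset.prod_subtype_eq_prod_filter (f := fun e => P (f e ⁻¹' B e)),
      Finset.prod_filter]
    refine Finset.prod_congr rfl fun e he => ?_
    by_cases hS : S e
    · rw [if_pos hS]
    · rw [if_neg hS, huniv e he hS, measure_univ]

lemma IsBlockGaussian.iIndepFun [IsProbabilityMeasure P] {Y : Ω → Matrix (Fin n) (Fin m) ℝ}
    (hY : IsBlockGaussian P d₁ d₂ Y) :
    iIndepFun (fun (e : Fin n × Fin m) ω => Y ω e.1 e.2) P :=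
  iIndepFun_of_subtype_of_const hY.2.1 fun e he ω => hY.2.2.2 e.1 e.2 he ω

lemma integrable_pow_gaussianReal (k : ℕ) :
    Integrable (fun x : ℝ => x ^ k) (gaussianReal 0 1) := by
  rcases Nat.eq_zero_or_pos k with rfl | hk
  · simp
  · have h := (memLp_id_gaussianReal (μ := 0) (v := 1) k).integrable_norm_pow hk.ne'
    refine (integrable_norm_iff (by fun_prop)).mp ?_
    simpa using h

/-- This lets the entries of `Y` themselves play the role of the `ξ`, with value 0 outside the
blocks. -/
lemma IsBlockGaussian.eq_mul {Y : Ω → Matrix (Fin n) (Fin m) ℝ}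
    (hY : IsBlockGaussian P d₁ d₂ Y) (ω : Ω) (i : Fin n) (j : Fin m) :
    Y ω i j = blockCoeff n m d₁ d₂ i j * Y ω i j := by
  by_cases h : InBlock d₁ d₂ (i, j)
  · rw [show blockCoeff n m d₁ d₂ i j = 1 from if_pos h, one_mul]
  · rw [hY.2.2.2 i j h, mul_zero]

lemma IsBlockGaussian.integrable_pow [IsProbabilityMeasure P]
    {Y : Ω → Matrix (Fin n) (Fin m) ℝ}
    (hY : IsBlockGaussian P d₁ d₂ Y) (e : Fin n × Fin m) (k : ℕ) :
    Integrable (fun ω => Y ω e.1 e.2 ^ k) P := by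
  by_cases h : InBlock d₁ d₂ e
  · have h1 := integrable_pow_gaussianReal k
    rw [← hY.2.2.1 e.1 e.2 h] at h1
    exact h1.comp_measurable (hY.1 _ _)
  · simp [hY.2.2.2 e.1 e.2 h]

lemma IsBlockGaussian.isAdmissible [IsProbabilityMeasure P] (hn : 0 < n) (hm : 0 < m)
    (hd₁ : 0 < d₁) (hd₂ : 0 < d₂) (hdvd : d₁ ∣ n) (hnm : n / d₁ * d₂ ≤ m)
    {Y : Ω → Matrix (Fin n) (Fin m) ℝ} (hY : IsBlockGaussian P d₁ d₂ Y) :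
    IsAdmissible P d₁ d₂ Y := by
  have : Nonempty (Fin n) := ⟨⟨0, hn⟩⟩
  have : Nonempty (Fin m) := ⟨⟨0, hm⟩⟩
  refine ⟨blockCoeff n m d₁ d₂, ⟨blockCoeff_nonneg d₁ d₂, fun e ω => Y ω e.1 e.2,
    fun e => hY.1 _ _, hY.iIndepFun, fun e => ?_, fun e p => ⟨hY.integrable_pow e _, ?_⟩,
    hY.eq_mul⟩, ?_, ?_, ?_⟩
  · by_cases h : InBlock d₁ d₂ e
    · have h1 : P.map (fun ω => -Y ω e.1 e.2) =
          (P.map fun ω => Y ω e.1 e.2).map (fun x => -x) :=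
        (Measure.map_map measurable_neg (hY.1 _ _)).symm
      rw [h1, hY.2.2.1 e.1 e.2 h, gaussianReal_map_neg, neg_zero]
    · simp [hY.2.2.2 e.1 e.2 h]
  · by_cases h : InBlock d₁ d₂ e
    · rw [← hY.2.2.1 e.1 e.2 h, integral_map (hY.1 _ _).aemeasurable
        (by fun_prop)]
    -- For a zero entry the moment of order 0 is 1, not 0.
    · rcases Nat.eq_zero_or_pos p with rfl | hp
      · simp
      · simp only [hY.2.2.2 e.1 e.2 h, zero_pow (show 2 * p ≠ 0 by lia), integral_zero]
        exact integral_nonneg fun x => (even_two_mul p).pow_nonneg x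
  · have h0 (e : Fin n × Fin m) : blockCoeff n m d₁ d₂ e.1 e.2 ^ 2 ≤ 1 := by
      rw [blockCoeff]
      split_ifs <;> norm_num
    refine le_antisymm (ciSup_le h0) ?_
    -- The corner position always lies in the first block.
    refine le_ciSup_of_le (Set.finite_range _).bddAbove (⟨0, hn⟩, ⟨0, hm⟩) ?_
    simp [blockCoeff]
  · exact ciSup_le fun j => sum_col_blockCoeff_le hd₁ hdvd j
  · exact ciSup_le fun i => (sum_row_blockCoeff hd₂ hdvd hnm i).le

lemma exists_isBlockGaussian (n m d₁ d₂ : ℕ) :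
    ∃ (Ω : Type) (_ : MeasurableSpace Ω) (P : Measure Ω) (Y : Ω → Matrix (Fin n) (Fin m) ℝ),
      IsProbabilityMeasure P ∧ IsBlockGaussian P d₁ d₂ Y := by
  classical
  refine ⟨Fin n × Fin m → ℝ, inferInstance, Measure.pi fun _ => gaussianReal 0 1,
    fun ω i j => if InBlock d₁ d₂ (i, j) then ω (i, j) else 0, inferInstance, ?_, ?_, ?_, ?_⟩
  · intro i j
    by_cases h : InBlock d₁ d₂ (i, j)
    · simpa [h] using measurable_pi_apply _
    · simp [h]
  · have h1 := iIndepFun_pi (μ := fun _ : Fin n × Fin m => gaussianReal 0 1)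
      (X := fun _ x => x) fun _ => aemeasurable_id
    have h2 := h1.precomp (g := fun e : {e : Fin n × Fin m // InBlock d₁ d₂ e} => e.1)
      Subtype.val_injective
    refine (iIndepFun_congr fun e => ?_).mp h2
    exact .of_forall fun ω => by simp [e.2]
  · intro i j h
    simp only [h, if_true]
    exact (measurePreserving_eval (fun _ : Fin n × Fin m => gaussianReal 0 1) (i, j)).map_eq
  · intro i j h ω
    simp [h]

end Model

end RandMat

/-- Block-diagonal Gaussian matrices exist, are admissible, and have the largest unnormalized
trace moments, of every order, among all admissible random matrices of the same size. -/
theorem corollary1p7 (n m d₁ d₂ : ℕ) (hn : 0 < n) (hm : 0 < m) (hd₁ : 0 < d₁) (hd₂ : 0 < d₂)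
    (hdvd : d₁ ∣ n) (hratio : (n : ℝ) / (d₁ : ℝ) ≤ (m : ℝ) / (d₂ : ℝ)) :
    (∃ (Ω : Type) (_ : MeasurableSpace Ω) (P : Measure Ω)
        (Y : Ω → Matrix (Fin n) (Fin m) ℝ),
        IsProbabilityMeasure P ∧ RandMat.IsBlockGaussian P d₁ d₂ Y) ∧
    ∀ (Ω' : Type*) [MeasurableSpace Ω'] (P' : Measure Ω') [IsProbabilityMeasure P']
      (Y : Ω' → Matrix (Fin n) (Fin m) ℝ), RandMat.IsBlockGaussian P' d₁ d₂ Y →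
      RandMat.IsAdmissible P' d₁ d₂ Y ∧
      (∀ p : ℕ, Integrable (RandMat.tracePow Y p) P') ∧
      ∀ (Ω : Type*) [MeasurableSpace Ω] (P : Measure Ω) [IsProbabilityMeasure P]
        (X : Ω → Matrix (Fin n) (Fin m) ℝ), RandMat.IsAdmissible P d₁ d₂ X →
        ∀ p : ℕ, Integrable (RandMat.tracePow X p) P ∧
          ∫ ω, RandMat.tracePow X p ω ∂P ≤ ∫ ω, RandMat.tracePow Y p ω ∂P' := by
  have hnm := RandMat.div_mul_le_of_ratio hd₁ hd₂ hdvd hratio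
  let e₀ : Fin n × Fin m := (⟨0, hn⟩, ⟨0, hm⟩)
  refine ⟨RandMat.exists_isBlockGaussian n m d₁ d₂, fun Ω' _ P' _ Y hY =>
    ⟨hY.isAdmissible hn hm hd₁ hd₂ hdvd hnm, ?_, ?_⟩⟩
  · exact RandMat.integrable_tracePow e₀ (fun e => hY.1 e.1 e.2) hY.iIndepFun hY.integrable_pow
      hY.eq_mul
  · rintro Ω _ P _ X ⟨b, ⟨hb, ξ, hmeas, hi, hs, hmom, hX⟩, h0, h1, h2⟩ p
    have hint (e : Fin n × Fin m) := RandMat.integrable_pow_of_even (hmeas e) fun p => (hmom e p).1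
    refine ⟨RandMat.integrable_tracePow e₀ hmeas hi hint hX p, ?_⟩
    have hb1 (i : Fin n) (j : Fin m) : b i j ≤ 1 := by
      have : b i j ^ 2 ≤ 1 := h0 ▸ le_ciSup (f := fun e : Fin n × Fin m => b e.1 e.2 ^ 2)
        (Set.finite_range _).bddAbove (i, j)
      exact (sq_le_one_iff₀ (hb i j)).mp this
    rw [RandMat.integral_tracePow_eq (b := RandMat.blockCoeff n m d₁ d₂) e₀
      (fun e => hY.1 e.1 e.2) hY.iIndepFun hY.integrable_pow ?_ hY.eq_mul]
    · refine (RandMat.integral_tracePow_le e₀ hb hmeas hi hint hs (fun e p => (hmom e p).2)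
        hX p).trans (Finset.sum_le_sum fun π hπ => ?_)
      exact (RandMat.pairedSum_le e₀ hπ hb hb1
        (fun j => (le_ciSup (f := fun j => ∑ i, b i j ^ 2) (Set.finite_range _).bddAbove j).trans h1)
        (fun i => (le_ciSup (f := fun i => ∑ j, b i j ^ 2)
          (Set.finite_range _).bddAbove i).trans h2)).trans
        (RandMat.le_pairedSum_blockCoeff e₀ (even_two_mul p) hd₁ hd₂ hdvd hnm)
    · intro i j h
      refine hY.2.2.1 i j ?_
      by_contra hblock
      exact h (if_neg hblock)
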